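/- For a permutation $\pi=\pi_1\cdots\pi_n\in\mathfrak S_n$ let $\operatorname{inv}(\pi)=\#\{i<j:\pi_i>\pi_j\}$, $\operatorname{des}(\pi)=\#\{i\in[n-1]:\pi_i>\pi_{i+1}\}$ and $\operatorname{pk}(\pi)=\#\{2\le i\le n-1:\pi_{i-1}<\pi_i>\pi_{i+1}\}$, and for $n\ge 1$ put $$P_n^{(\operatorname{inv},\operatorname{pk},\operatorname{des})}(q,y,t)=\sum_{\pi\in\mathfrak S_n}q^{\operatorname{inv}(\pi)}y^{\operatorname{pk}(\pi)+1}t^{\operatorname{des}(\pi)+1}.$$ Let $[n]_q!=\prod_{k=1}^n(1+q+\cdots+q^{k-1})$, $\exp_q(x)=\sum_{n\ge0}\frac{x^n}{[n]_q!}$ and $\operatorname{Exp}_q(x)=\sum_{n\ge0}q^{\binom n2}\frac{x^n}{[n]_q!}$. Let $K$ be a field and let $q\in K$ satisfy $[n]_q!\ne0$ for all $n$. The following are identities of formal power series in $K[[x]]$. (1) For all $y,t\in K$ with $1-t$, $1+y$, $y+t$, $1+yt$ all nonzero, $$\frac{1-t}{1-t\operatorname{Exp}_q(yx)\exp_q(x)}=1+\sum_{n=1}^\infty\frac{(1+yt)^{n+1}}{(1+y)(1-t)^n}\,P_n^{(\operatorname{inv},\operatorname{pk},\operatorname{des})}\!\left(q,\frac{(1+y)^2t}{(y+t)(1+yt)},\frac{y+t}{1+yt}\right)\frac{x^n}{[n]_q!}.$$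 (2) Suppose $2\ne0$ in $K$, let $y,t\in K$ with $y\neq0$, $y\ne1$, $t\ne0$ and $(1+t)^2-4yt\neq0$, and suppose that $(1+t)^2-4yt$ has a square root in $K$; let $\sqrt{(1+t)^2-4yt}$ denote either of its square roots. Put $$u=\frac{1+t^2-2yt-(1-t)\sqrt{(1+t)^2-4yt}}{2(1-y)t},\qquad v=\frac{(1+t)^2-2yt-(1+t)\sqrt{(1+t)^2-4yt}}{2yt}.$$ Then $1+uv\ne0$, $1-v\neq0$, and $$\sum_{n=1}^\infty P_n^{(\operatorname{inv},\operatorname{pk},\operatorname{des})}(q,y,t)\frac{x^n}{[n]_q!}=\frac{v(1+u)}{1+uv}\cdot\frac{\operatorname{Exp}_q\!\left(\frac{u(1-v)}{1+uv}x\right)\exp_q\!\left(\frac{1-v}{1+uv}x\right)-1}{1-v\operatorname{Exp}_q\!\left(\frac{u(1-v)}{1+uv}x\right)\exp_q\!\left(\frac{1-v}{1+uv}x\right)}.$$ -/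

import Mathlib

namespace PkDes

/-- The inversion number of `π = π₁ ⋯ πₙ`: the number of pairs `i < j` with `πᵢ > πⱼ`. -/
def inv {n : ℕ} (π : Equiv.Perm (Fin n)) : ℕ :=
  (Finset.univ.filter fun p : Fin n × Fin n => p.1 < p.2 ∧ π p.2 < π p.1).card

/-- The descent number: the number of positions `i` that have a successor `i + 1`
and satisfy `πᵢ > πᵢ₊₁`. -/
def des {n : ℕ} (π : Equiv.Perm (Fin n)) : ℕ :=
  (Finset.univ.filter fun i : Fin n =>
    ∃ h : (i : ℕ) + 1 < n, π ⟨(i : ℕ) + 1, h⟩ < π i).card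

/-- The peak number: the number of interior positions `i` with `πᵢ₋₁ < πᵢ > πᵢ₊₁`. -/
def pk {n : ℕ} (π : Equiv.Perm (Fin n)) : ℕ :=
  (Finset.univ.filter fun i : Fin n =>
    0 < (i : ℕ) ∧ ∃ h : (i : ℕ) + 1 < n,
      π ⟨(i : ℕ) - 1, (Nat.sub_le _ _).trans_lt i.isLt⟩ < π i ∧ π ⟨(i : ℕ) + 1, h⟩ < π i).card

/-- The value at `(q, y, t)` of the polynomial `∑_π q^inv(π) y^(pk(π)+1) t^(des(π)+1)`, the sum
being over all permutations of length `n`; the `0`th polynomial is `1` by convention. -/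
def invPkDes {R : Type*} [CommRing R] (n : ℕ) (q y t : R) : R :=
  if n = 0 then 1
  else ∑ π : Equiv.Perm (Fin n), q ^ inv π * y ^ (pk π + 1) * t ^ (des π + 1)

/-- `[n]_q = 1 + q + ⋯ + q^(n-1)`. -/
def qNumber {R : Type*} [CommRing R] (q : R) (n : ℕ) : R :=
  ∑ i ∈ Finset.range n, q ^ i

/-- `[n]_q! = [1]_q [2]_q ⋯ [n]_q`. -/
def qFactorial {R : Type*} [CommRing R] (q : R) (n : ℕ) : R :=
  ∏ i ∈ Finset.range n, qNumber q (i + 1)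

/-- The formal power series `exp_q(x) = ∑ xⁿ / [n]_q!`. -/
noncomputable def expq {K : Type*} [Field K] (q : K) : PowerSeries K :=
  PowerSeries.mk fun n => (qFactorial q n)⁻¹

/-- The formal power series `Exp_q(x) = ∑ q^(n choose 2) xⁿ / [n]_q!`. -/
noncomputable def bigExpq {K : Type*} [Field K] (q : K) : PowerSeries K :=
  PowerSeries.mk fun n => q ^ n.choose 2 * (qFactorial q n)⁻¹

end PkDes

namespace PkDes

open Finset PowerSeries

/-! ### Gluing permutations along a subset -/

/-! Let `W` be `weightSeries`, in which a permutation is weighted by a product over its letters,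
placed between two infinite letters: one factor each for valleys, peaks, double ascents and double
descents. Valleys outnumber peaks by one, and descents are peaks plus double descents, so this
product depends only on length, `pk` and `des`. Hence `W` is the right side of (1)
(`patternWeight_eq`, `weightSeries_eq`).

As `Exp_q(yx) exp_q(-yx) = 1`, (1) amounts to `(exp_q(-yx) - t exp_q(x)) W = (1 - t) exp_q(-yx)`.
Only the identity has no descents, so `1/[k]_q!` is the `inv` series of increasing words of length
`k`, and multiplying such series concatenates words (`sum_pow_inv_div_qFactorial_mul`). The
coefficients then agree permutation by permutation: what remains is an identity for a single descent
word, summed over its increasing prefixes (`sum_incr_mul_wordWeight`).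

For (2), `peak_descent_parametrization` inverts the substitution in (1); then `x` is rescaled. -/

theorem card_compl_of_card_eq {a b : ℕ} {S : Finset (Fin (a + b))} (hS : S.card = a) :
    Sᶜ.card = b := by
  rw [card_compl, Fintype.card_fin, hS, Nat.add_sub_cancel_left]

/-- The permutation of length `a + b` whose first `a` values form the set `S` and are ordered as
in `σ`, and whose last `b` values are ordered as in `τ`. -/
def glue {a b : ℕ} (S : {S : Finset (Fin (a + b)) // S.card = a})
    (σ : Equiv.Perm (Fin a)) (τ : Equiv.Perm (Fin b)) : Equiv.Perm (Fin (a + b)) :=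
  finSumFinEquiv.symm.trans
    ((Equiv.sumCongr σ τ).trans (finSumEquivOfFinset S.2 (card_compl_of_card_eq S.2)))

@[simp]
theorem glue_castAdd {a b : ℕ} (S : {S : Finset (Fin (a + b)) // S.card = a})
    (σ : Equiv.Perm (Fin a)) (τ : Equiv.Perm (Fin b)) (i : Fin a) :
    glue S σ τ (Fin.castAdd b i) = S.1.orderEmbOfFin S.2 (σ i) := by
  simp [glue]

@[simp]
theorem glue_natAdd {a b : ℕ} (S : {S : Finset (Fin (a + b)) // S.card = a})
    (σ : Equiv.Perm (Fin a)) (τ : Equiv.Perm (Fin b)) (i : Fin b) :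
    glue S σ τ (Fin.natAdd a i) =
      S.1ᶜ.orderEmbOfFin (card_compl_of_card_eq S.2) (τ i) := by
  simp [glue]

theorem image_glue_castAdd {a b : ℕ} (S : {S : Finset (Fin (a + b)) // S.card = a})
    (σ : Equiv.Perm (Fin a)) (τ : Equiv.Perm (Fin b)) :
    univ.image (fun i : Fin a => glue S σ τ (Fin.castAdd b i)) = S.1 := by
  apply Finset.eq_of_subset_of_card_le
  · intro x hx
    simp only [mem_image, mem_univ, true_and, glue_castAdd] at hx
    obtain ⟨i, rfl⟩ := hx
    exact Finset.orderEmbOfFin_mem _ _ _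
  · rw [card_image_of_injective, card_univ, Fintype.card_fin, S.2]
    exact (glue S σ τ).injective.comp (Fin.castAdd_injective a b)

theorem glue_bijective (a b : ℕ) :
    Function.Bijective fun x : {S : Finset (Fin (a + b)) // S.card = a} ×
      Equiv.Perm (Fin a) × Equiv.Perm (Fin b) => glue x.1 x.2.1 x.2.2 := by
  constructor
  · rintro ⟨S, σ, τ⟩ ⟨S', σ', τ'⟩ h
    simp only at h
    obtain rfl : S = S' := by
      apply Subtype.ext
      rw [← image_glue_castAdd S σ τ, ← image_glue_castAdd S' σ' τ', h]
    obtain rfl : σ = σ' := by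
      ext i : 1
      have := congrArg (fun π => π (Fin.castAdd b i)) h
      simpa using this
    obtain rfl : τ = τ' := by
      ext i : 1
      have := congrArg (fun π => π (Fin.natAdd a i)) h
      simpa using this
    rfl
  · intro π
    let S : {S : Finset (Fin (a + b)) // S.card = a} :=
      ⟨univ.image fun i : Fin a => π (Fin.castAdd b i), by
        rw [card_image_of_injective, card_univ, Fintype.card_fin]
        exact π.injective.comp (Fin.castAdd_injective a b)⟩
    let e := finSumEquivOfFinset S.2 (card_compl_of_card_eq S.2)
    let ρ : Equiv.Perm (Fin a ⊕ Fin b) := finSumFinEquiv.trans (π.trans e.symm)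
    -- By the choice of `S`, `ρ` maps the left summand to itself, hence splits into a permutation of
    -- each summand.
    have hρ : ρ ∈ (Equiv.Perm.sumCongrHom (Fin a) (Fin b)).range := by
      apply Equiv.Perm.mem_sumCongrHom_range_of_perm_mapsTo_inl
      rintro _ ⟨i, rfl⟩
      have hmem : π (Fin.castAdd b i) ∈ S.1 := mem_image_of_mem _ (mem_univ i)
      rw [← Finset.mem_coe, ← Finset.range_orderEmbOfFin S.1 S.2] at hmem
      obtain ⟨j, hj⟩ := hmem
      refine ⟨j, ?_⟩
      simp only [ρ, Equiv.trans_apply, finSumFinEquiv_apply_left, ← hj]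
      rw [Equiv.eq_symm_apply]
      simp [e]
    obtain ⟨⟨σ, τ⟩, hστ⟩ := hρ
    refine ⟨⟨S, σ, τ⟩, ?_⟩
    have h : Equiv.sumCongr σ τ = ρ := hστ
    ext i : 1
    simp [glue, h, ρ, e]

/-- The number of pairs `(s, r)` with `s ∈ S`, `r ∉ S` and `r < s`. -/
def crossInv {n : ℕ} (S : Finset (Fin n)) : ℕ :=
  ∑ s ∈ S, ∑ r ∈ Sᶜ, if r < s then 1 else 0

theorem inv_eq_sum {n : ℕ} (π : Equiv.Perm (Fin n)) :
    inv π = ∑ i, ∑ j, if i < j ∧ π j < π i then 1 else 0 := by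
  rw [inv, card_filter, ← univ_product_univ, sum_product]

theorem sum_orderEmbOfFin {n k : ℕ} {M : Type*} [AddCommMonoid M] (S : Finset (Fin n))
    (hS : S.card = k) (f : Fin n → M) : ∑ i, f (S.orderEmbOfFin hS i) = ∑ s ∈ S, f s := by
  conv_rhs => rw [← Finset.image_orderEmbOfFin_univ S hS]
  rw [sum_image fun _ _ _ _ h => (S.orderEmbOfFin hS).injective h]

/-- A position of the first block precedes every position of the second, so cross inversions depend
on values alone; `σ` and `τ` only reindex their count. -/
theorem inv_glue {a b : ℕ} (S : {S : Finset (Fin (a + b)) // S.card = a})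
    (σ : Equiv.Perm (Fin a)) (τ : Equiv.Perm (Fin b)) :
    inv (glue S σ τ) = crossInv S.1 + inv σ + inv τ := by
  have hcross : ∑ i : Fin a, ∑ j : Fin b,
      (if S.1ᶜ.orderEmbOfFin (card_compl_of_card_eq S.2) (τ j) < S.1.orderEmbOfFin S.2 (σ i)
        then 1 else 0) = crossInv S.1 := by
    rw [crossInv, ← sum_orderEmbOfFin S.1 S.2]
    refine (Equiv.sum_comp σ fun i => ∑ j : Fin b,
      if S.1ᶜ.orderEmbOfFin (card_compl_of_card_eq S.2) (τ j) < S.1.orderEmbOfFin S.2 i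
        then 1 else 0).trans (sum_congr rfl fun i _ => ?_)
    rw [← sum_orderEmbOfFin S.1ᶜ (card_compl_of_card_eq S.2)]
    exact Equiv.sum_comp τ fun j =>
      if S.1ᶜ.orderEmbOfFin (card_compl_of_card_eq S.2) j < S.1.orderEmbOfFin S.2 i then 1 else 0
  have h1 (i : Fin a) (j : Fin b) : Fin.castAdd b i < Fin.natAdd a j := by
    rw [Fin.lt_def]; simp; omega
  have h2 (i : Fin a) (j : Fin b) : ¬ Fin.natAdd a j < Fin.castAdd b i := (h1 i j).le.not_gt
  have h3 (i j : Fin a) : Fin.castAdd b i < Fin.castAdd b j ↔ i < j := Iff.rfl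
  have h4 (i j : Fin b) : Fin.natAdd a i < Fin.natAdd a j ↔ i < j := by simp
  rw [inv_eq_sum, Fin.sum_univ_add]
  simp only [Fin.sum_univ_add, glue_castAdd, glue_natAdd, h1, h2, h3, h4, OrderEmbedding.lt_iff_lt,
    true_and, false_and, if_false, sum_const_zero, zero_add, sum_add_distrib]
  rw [hcross, ← inv_eq_sum, ← inv_eq_sum]
  ring

/-! ### The product formula for inversion generating functions -/

theorem sum_pow_inv_mul_of_glue {R : Type*} [CommRing R] (q : R) {a b : ℕ}
    (f : Equiv.Perm (Fin a) → R) (g : Equiv.Perm (Fin b) → R)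
    (h : Equiv.Perm (Fin (a + b)) → R) (hfg : ∀ S σ τ, h (glue S σ τ) = f σ * g τ) :
    ∑ π, q ^ inv π * h π =
      (∑ S : {S : Finset (Fin (a + b)) // S.card = a}, q ^ crossInv S.1) *
        (∑ σ, q ^ inv σ * f σ) * ∑ τ, q ^ inv τ * g τ := by
  rw [← Function.Bijective.sum_comp (glue_bijective a b) (fun π => q ^ inv π * h π),
    Fintype.sum_prod_type, mul_assoc, sum_mul_sum, sum_mul]
  refine sum_congr rfl fun S _ => ?_
  rw [Fintype.sum_prod_type, mul_sum]
  refine sum_congr rfl fun σ _ => ?_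
  rw [mul_sum]
  refine sum_congr rfl fun τ _ => ?_
  rw [hfg, inv_glue]
  ring

theorem crossInv_singleton {n : ℕ} (s : Fin n) : crossInv {s} = s := by
  rw [crossInv, sum_singleton, ← card_filter]
  rw [show ({s}ᶜ : Finset (Fin n)).filter (· < s) = Finset.Iio s by
    ext r; simpa using fun h => ne_of_lt h]
  simp

theorem sum_pow_crossInv_one {R : Type*} [CommRing R] (q : R) (n : ℕ) :
    ∑ S : {S : Finset (Fin (1 + n)) // S.card = 1}, q ^ crossInv S.1 = qNumber q (n + 1) := by
  rw [qNumber, add_comm n 1, ← Fin.sum_univ_eq_sum_range (fun i => q ^ i) (1 + n)]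
  symm
  refine Fintype.sum_bijective (fun s => ⟨{s}, card_singleton s⟩) ⟨?_, ?_⟩ _ _ ?_
  · intro s r h
    simpa using h
  · rintro ⟨S, hS⟩
    obtain ⟨s, rfl⟩ := card_eq_one.1 hS
    exact ⟨s, rfl⟩
  · intro s
    simp [crossInv_singleton]

theorem sum_pow_inv {R : Type*} [CommRing R] (q : R) (n : ℕ) :
    ∑ π : Equiv.Perm (Fin n), q ^ inv π = qFactorial q n := by
  induction n with
  | zero => simp [inv, qFactorial]
  | succ n ih =>
    have h := sum_pow_inv_mul_of_glue q (a := 1) (b := n) (fun _ => 1) (fun _ => 1) (fun _ => 1)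
      (by simp)
    simp only [mul_one] at h
    rw [sum_pow_crossInv_one, ih] at h
    rw [add_comm n 1, h]
    have : qFactorial q (1 + n) = qFactorial q n * qNumber q (n + 1) := by
      rw [add_comm, qFactorial, prod_range_succ, qFactorial]
    have hone : ∑ π : Equiv.Perm (Fin 1), q ^ inv π = 1 := by
      simp [inv, Subsingleton.elim (α := Fin 1) _ 0]
    rw [this, hone]
    ring

theorem sum_pow_inv_div_qFactorial_mul {K : Type*} [Field K] {q : K}
    (hq : ∀ n : ℕ, qFactorial q n ≠ 0) {a b : ℕ}
    (f : Equiv.Perm (Fin a) → K) (g : Equiv.Perm (Fin b) → K)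
    (h : Equiv.Perm (Fin (a + b)) → K) (hfg : ∀ S σ τ, h (glue S σ τ) = f σ * g τ) :
    (∑ σ, q ^ inv σ * f σ) / qFactorial q a * ((∑ τ, q ^ inv τ * g τ) / qFactorial q b) =
      (∑ π, q ^ inv π * h π) / qFactorial q (a + b) := by
  -- The sum over `S` is the `q`-binomial coefficient; constant weights identify it as a ratio of
  -- `q`-factorials.
  have h1 := sum_pow_inv_mul_of_glue q (a := a) (b := b) (fun _ => 1) (fun _ => 1) (fun _ => 1)
    (by simp)
  simp only [mul_one, sum_pow_inv] at h1
  have hC : (∑ S : {S : Finset (Fin (a + b)) // S.card = a}, q ^ crossInv S.1) ≠ 0 := by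
    intro h0
    exact hq (a + b) (by rw [h1, h0]; ring)
  rw [sum_pow_inv_mul_of_glue q f g h hfg, h1]
  have := hq a
  have := hq b
  field_simp

/-! ### The inverse of a `q`-exponential -/

theorem qNumber_add {R : Type*} [CommRing R] (q : R) (m n : ℕ) :
    qNumber q (m + n) = qNumber q m + q ^ m * qNumber q n := by
  simp [qNumber, sum_range_add, mul_sum, pow_add]

/-- The operator `x D_q`, where `D_q` is the `q`-derivative. -/
noncomputable def qEuler {R : Type*} [CommRing R] (q : R) (f : PowerSeries R) : PowerSeries R :=
  PowerSeries.mk fun n => qNumber q n * coeff n f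

theorem qEuler_mul {R : Type*} [CommRing R] (q : R) (f g : PowerSeries R) :
    qEuler q (f * g) = qEuler q f * g + rescale q f * qEuler q g := by
  ext n
  simp only [qEuler, coeff_mk, coeff_mul, map_add, coeff_rescale, mul_sum, ← sum_add_distrib]
  refine sum_congr rfl fun p hp => ?_
  rw [← mem_antidiagonal.1 hp, qNumber_add]
  ring

theorem qNumber_mul_inv_qFactorial {K : Type*} [Field K] {q : K}
    (hq : ∀ n : ℕ, qFactorial q n ≠ 0) (n : ℕ) :
    qNumber q (n + 1) * (qFactorial q (n + 1))⁻¹ = (qFactorial q n)⁻¹ := by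
  have h : qFactorial q (n + 1) = qFactorial q n * qNumber q (n + 1) := by
    rw [qFactorial, prod_range_succ, qFactorial]
  have h1 := hq (n + 1)
  rw [h] at h1 ⊢
  have := left_ne_zero_of_mul h1
  have := right_ne_zero_of_mul h1
  field_simp

theorem qEuler_rescale_expq {K : Type*} [Field K] {q : K}
    (hq : ∀ n : ℕ, qFactorial q n ≠ 0) (c : K) :
    qEuler q (rescale c (expq q)) = C c * X * rescale c (expq q) := by
  ext n
  rw [mul_assoc, coeff_C_mul]
  cases n with
  | zero => simp [qEuler, qNumber]
  | succ n =>
    rw [coeff_succ_X_mul]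
    simp only [qEuler, coeff_mk, coeff_rescale, expq]
    rw [← qNumber_mul_inv_qFactorial hq n]
    ring

theorem qEuler_rescale_bigExpq {K : Type*} [Field K] {q : K}
    (hq : ∀ n : ℕ, qFactorial q n ≠ 0) (c : K) :
    qEuler q (rescale c (bigExpq q)) = C c * X * rescale q (rescale c (bigExpq q)) := by
  ext n
  rw [mul_assoc, coeff_C_mul]
  cases n with
  | zero => simp [qEuler, qNumber]
  | succ n =>
    rw [coeff_succ_X_mul]
    simp only [qEuler, coeff_mk, coeff_rescale, bigExpq]
    rw [← qNumber_mul_inv_qFactorial hq n, Nat.choose_succ_succ' n 1, Nat.choose_one_right]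
    ring

theorem constantCoeff_rescale_mul_rescale {K : Type*} [Field K] (q c d : K) :
    constantCoeff (rescale c (bigExpq q) * rescale d (expq q)) = 1 := by
  rw [← coeff_zero_eq_constantCoeff_apply, coeff_mul]
  simp only [Nat.antidiagonal_zero, sum_singleton, coeff_rescale, bigExpq, expq, coeff_mk]
  simp [qFactorial]

/-- By the twisted Leibniz rule `x D_q` kills the product, and it multiplies the `n`th coefficient
by `[n]_q`, nonzero for `n ≥ 1`; only the constant term survives. -/
theorem rescale_bigExpq_mul_rescale_neg_expq {K : Type*} [Field K] {q : K}
    (hq : ∀ n : ℕ, qFactorial q n ≠ 0) (c : K) :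
    rescale c (bigExpq q) * rescale (-c) (expq q) = 1 := by
  have h : qEuler q (rescale c (bigExpq q) * rescale (-c) (expq q)) = 0 := by
    rw [qEuler_mul, qEuler_rescale_expq hq, qEuler_rescale_bigExpq hq, map_neg]
    ring
  ext n
  cases n with
  | zero =>
    rw [coeff_zero_eq_constantCoeff_apply, constantCoeff_rescale_mul_rescale, coeff_zero_one]
  | succ n =>
    have hn := congrArg (coeff (n + 1)) h
    simp only [qEuler, coeff_mk, map_zero] at hn
    have hq' : qNumber q (n + 1) ≠ 0 := by
      have h1 := hq (n + 1)
      rw [qFactorial, prod_range_succ] at h1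
      exact right_ne_zero_of_mul h1
    rw [(mul_eq_zero.1 hn).resolve_left hq']
    simp [coeff_one]

/-! ### Weights of descent words -/

/-- The product over the letters of a word of length `ℓ + 1` with descent pattern `w`, preceded by
a descent if `p` holds and by an ascent otherwise, and followed by an ascent, of the following
factors: `1 + y` for a valley, `y + t` for a double descent, `(1 + y) * t` for a peak, and
`1 + y * t` for a double ascent. -/
def patternWeight {K : Type*} [Field K] (y t : K) : Bool → ℕ → (ℕ → Bool) → K
  | true, 0, _ => 1 + y
  | false, 0, _ => 1 + y * t
  | true, ℓ + 1, w =>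
    if w 0 then (y + t) * patternWeight y t true ℓ (fun i => w (i + 1))
    else (1 + y) * patternWeight y t false ℓ (fun i => w (i + 1))
  | false, ℓ + 1, w =>
    if w 0 then (1 + y) * t * patternWeight y t true ℓ (fun i => w (i + 1))
    else (1 + y * t) * patternWeight y t false ℓ (fun i => w (i + 1))

/-- The normalized weight of a word of length `n` with descent pattern `w`. -/
def wordWeight {K : Type*} [Field K] (y t : K) : ℕ → (ℕ → Bool) → K
  | 0, _ => 1
  | ℓ + 1, w => t / (1 - t) ^ (ℓ + 1) * patternWeight y t true ℓ w

/-- The indicator of the first `k` letters being increasing. -/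
def incr (K : Type*) [Field K] (k : ℕ) (w : ℕ → Bool) : K :=
  if ∀ i < k - 1, w i = false then 1 else 0

/-- Sum over the nonempty increasing prefixes of a word of length `n`. -/
def prefixSum {K : Type*} [Field K] (y t c : K) (n : ℕ) (w : ℕ → Bool) : K :=
  ∑ k ∈ range n, (c * (-y) ^ k - t) * incr K (k + 1) w *
    wordWeight y t (n - (k + 1)) (fun i => w (i + (k + 1)))

theorem incr_one {K : Type*} [Field K] (w : ℕ → Bool) : incr K 1 w = 1 := by
  simp [incr]

theorem incr_add_two {K : Type*} [Field K] (k : ℕ) (w : ℕ → Bool) :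
    incr K (k + 2) w = if w 0 then 0 else incr K (k + 1) (fun i => w (i + 1)) := by
  unfold incr
  cases h : w 0 with
  | true => rw [if_neg (fun H => by simpa [h] using H 0 (by omega))]; simp
  | false =>
    simp only [Bool.false_eq_true, if_false]
    congr 1
    apply propext
    constructor
    · intro H i hi; exact H (i + 1) (by omega)
    · intro H i hi
      cases i with
      | zero => exact h
      | succ i => exact H i (by omega)

theorem prefixSum_one {K : Type*} [Field K] (y t c : K) (w : ℕ → Bool) :
    prefixSum y t c 1 w = c - t := by
  simp [prefixSum, incr_one, wordWeight]

theorem prefixSum_add_two {K : Type*} [Field K] (y t c : K) (n : ℕ) (w : ℕ → Bool) :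
    prefixSum y t c (n + 2) w = (c - t) * wordWeight y t (n + 1) (fun i => w (i + 1)) +
      if w 0 then 0 else prefixSum y t (c * -y) (n + 1) (fun i => w (i + 1)) := by
  rw [prefixSum, sum_range_succ', add_comm]
  congr 1
  · simp [incr_one]
  · simp only [incr_add_two]
    split_ifs
    · simp
    · refine sum_congr rfl fun k _ => ?_
      congr 1
      · ring
      · congr 1
        omega

/-- The parameter `c` is kept general because removing the first letter of an ascent replaces `c` by
`-y * c`. -/
theorem prefixSum_of_ascent {K : Type*} [Field K] {y t : K} (ht : 1 - t ≠ 0) (n : ℕ) (c : K)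
    (w : ℕ → Bool) (hw : w 0 = false) :
    prefixSum y t c (n + 2) w =
      (c - 1) * (t / (1 - t) ^ (n + 1)) * patternWeight y t false n (fun i => w (i + 1)) +
        c * (1 - t) * (-y) ^ (n + 1) * incr K (n + 1) (fun i => w (i + 1)) := by
  induction n generalizing c w with
  | zero =>
    rw [prefixSum_add_two, hw]
    simp only [zero_add, prefixSum_one, incr_one, wordWeight, patternWeight, Bool.false_eq_true, if_false]
    field_simp
    ring
  | succ n ih =>
    rw [prefixSum_add_two, hw, incr_add_two]
    simp only [Bool.false_eq_true, if_false, wordWeight, patternWeight]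
    cases h : w (0 + 1) with
    | true =>
      rw [prefixSum_add_two]
      simp only [h, if_true, wordWeight]
      field_simp
      ring
    | false =>
      rw [ih _ _ h]
      simp only [Bool.false_eq_true, if_false]
      field_simp
      ring

/-- The term `k = 0` is `(1 - t) * wordWeight y t n w`. After an initial descent only `k = 1` joins
it, and the factor `y + t` makes the two cancel; after an initial ascent the factor `1 + y` of the
first valley cancels the first term of `prefixSum_of_ascent`. -/
theorem sum_incr_mul_wordWeight {K : Type*} [Field K] {y t : K} (ht : 1 - t ≠ 0) (n : ℕ)
    (w : ℕ → Bool) :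
    ∑ k ∈ range (n + 1), ((-y) ^ k - t) * incr K k w *
      wordWeight y t (n - k) (fun i => w (i + k)) = (1 - t) * (-y) ^ n * incr K n w := by
  have key : ∑ k ∈ range (n + 1), ((-y) ^ k - t) * incr K k w *
      wordWeight y t (n - k) (fun i => w (i + k)) =
        prefixSum y t (-y) n w + (1 - t) * wordWeight y t n w := by
    rw [sum_range_succ', prefixSum]
    congr 1
    · refine sum_congr rfl fun k _ => ?_
      rw [pow_succ']
    · simp [incr]
  rw [key]
  match n with
  | 0 => simp [prefixSum, wordWeight, incr]
  | 1 =>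
    rw [prefixSum_one, incr_one]
    simp only [wordWeight, patternWeight]
    field_simp
    ring
  | n + 2 =>
    cases h : w 0 with
    | true =>
      rw [prefixSum_add_two, incr_add_two]
      simp only [h, if_true, wordWeight, patternWeight]
      field_simp
      ring
    | false =>
      rw [prefixSum_of_ascent ht n _ w h, incr_add_two]
      simp only [h, Bool.false_eq_true, if_false, wordWeight, patternWeight]
      field_simp
      ring

/-! ### Descent patterns of permutations -/

/-- The descent pattern of a permutation, extended by `false`. -/
def descPattern {n : ℕ} (π : Equiv.Perm (Fin n)) (i : ℕ) : Bool :=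
  if h : i + 1 < n then decide (π ⟨i + 1, h⟩ < π ⟨i, Nat.lt_of_succ_lt h⟩) else false

theorem descPattern_glue_of_lt {a b : ℕ} (S : {S : Finset (Fin (a + b)) // S.card = a})
    (σ : Equiv.Perm (Fin a)) (τ : Equiv.Perm (Fin b)) {i : ℕ} (hi : i + 1 < a) :
    descPattern (glue S σ τ) i = descPattern σ i := by
  have h1 := glue_castAdd S σ τ ⟨i + 1, hi⟩
  have h0 := glue_castAdd S σ τ ⟨i, Nat.lt_of_succ_lt hi⟩
  simp only [Fin.castAdd_mk] at h0 h1
  rw [descPattern, descPattern, dif_pos (by omega), dif_pos hi, h0, h1]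
  simp

theorem descPattern_glue_add {a b : ℕ} (S : {S : Finset (Fin (a + b)) // S.card = a})
    (σ : Equiv.Perm (Fin a)) (τ : Equiv.Perm (Fin b)) :
    (fun i => descPattern (glue S σ τ) (i + a)) = descPattern τ := by
  ext i : 1
  by_cases hi : i + 1 < b
  · have h1 := glue_natAdd S σ τ ⟨i + 1, hi⟩
    have h0 := glue_natAdd S σ τ ⟨i, Nat.lt_of_succ_lt hi⟩
    simp only [Fin.natAdd_mk] at h0 h1
    have e1 : a + (i + 1) = i + a + 1 := by omega
    have e0 : a + i = i + a := by omega
    simp only [e1, e0] at h0 h1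
    rw [descPattern, descPattern, dif_pos (by omega), dif_pos hi, h0, h1]
    simp
  · rw [descPattern, descPattern, dif_neg (by omega), dif_neg hi]

/-- The bound `k - 1` in `incr` stops short of the junction, so whether the two blocks meet in a
descent is immaterial. -/
theorem incr_descPattern_glue {K : Type*} [Field K] {a b : ℕ}
    (S : {S : Finset (Fin (a + b)) // S.card = a})
    (σ : Equiv.Perm (Fin a)) (τ : Equiv.Perm (Fin b)) :
    incr K a (descPattern (glue S σ τ)) = incr K a (descPattern σ) := by
  unfold incr
  congr 1
  apply propext
  refine forall_congr' fun i => forall_congr' fun hi => ?_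
  rw [descPattern_glue_of_lt S σ τ (by omega)]

theorem eq_one_of_descPattern_eq_false {n : ℕ} {π : Equiv.Perm (Fin n)}
    (h : ∀ i < n - 1, descPattern π i = false) : π = 1 := by
  have hmono : StrictMono π := by
    cases n with
    | zero => exact fun i => i.elim0
    | succ n =>
      rw [Fin.strictMono_iff_lt_succ]
      intro i
      have hi := h i (by omega)
      rw [descPattern, dif_pos (by omega), decide_eq_false_iff_not, not_lt] at hi
      refine lt_of_le_of_ne hi fun he => ?_
      exact absurd (π.injective he) (Fin.castSucc_lt_succ (i := i)).ne
  ext i : 1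
  exact congrFun ((StrictMono.range_inj hmono strictMono_id).1
    (by rw [π.surjective.range_eq, Function.surjective_id.range_eq])) i

theorem inv_one (n : ℕ) : inv (1 : Equiv.Perm (Fin n)) = 0 := by
  rw [inv, card_eq_zero, filter_eq_empty_iff]
  rintro p - ⟨h1, h2⟩
  exact lt_asymm h1 h2

theorem descPattern_one (n i : ℕ) : descPattern (1 : Equiv.Perm (Fin n)) i = false := by
  simp [descPattern]

theorem sum_pow_inv_mul_incr {K : Type*} [Field K] (q : K) (n : ℕ) :
    ∑ π : Equiv.Perm (Fin n), q ^ inv π * incr K n (descPattern π) = 1 := by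
  rw [sum_eq_single 1]
  · simp [inv_one, incr, descPattern_one]
  · intro π _ hπ
    rw [incr, if_neg fun h => hπ (eq_one_of_descPattern_eq_false h), mul_zero]
  · simp

/-- The generating function of permutations by inversions and weights of descent patterns. -/
noncomputable def weightSeries {K : Type*} [Field K] (q y t : K) : PowerSeries K :=
  PowerSeries.mk fun n => (∑ π : Equiv.Perm (Fin n),
    q ^ inv π * wordWeight y t n (descPattern π)) / qFactorial q n

theorem sub_mul_weightSeries {K : Type*} [Field K] {q y t : K}
    (hq : ∀ n : ℕ, qFactorial q n ≠ 0) (ht : 1 - t ≠ 0) :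
    (rescale (-y) (expq q) - C t * expq q) * weightSeries q y t =
      C (1 - t) * rescale (-y) (expq q) := by
  ext n
  have hterm (k m : ℕ) (h : k + m = n) :
      coeff k (rescale (-y) (expq q) - C t * expq q) * coeff m (weightSeries q y t) =
        (∑ π : Equiv.Perm (Fin n), q ^ inv π * (((-y) ^ k - t) * incr K k (descPattern π) *
          wordWeight y t (n - k) (fun i => descPattern π (i + k)))) / qFactorial q n := by
    subst h
    -- The factor `1/[k]_q!` enters as the sum over `σ` restricted to increasing words.
    have hprod := sum_pow_inv_div_qFactorial_mul hq (a := k) (b := m)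
      (fun σ => incr K k (descPattern σ)) (fun τ => wordWeight y t m (descPattern τ))
      (fun π => incr K k (descPattern π) * wordWeight y t m (fun i => descPattern π (i + k)))
      (fun S σ τ => by rw [incr_descPattern_glue, descPattern_glue_add])
    rw [sum_pow_inv_mul_incr] at hprod
    simp only [map_sub, coeff_rescale, coeff_C_mul, expq, coeff_mk, weightSeries,
      Nat.add_sub_cancel_left]
    rw [← one_div, ← sub_mul, mul_assoc, hprod, ← mul_div_assoc, mul_sum]
    congr 1
    refine sum_congr rfl fun π _ => ?_
    ring
  rw [coeff_mul, sum_congr rfl fun p hp => hterm p.1 p.2 (mem_antidiagonal.1 hp), ← sum_div,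
    sum_comm]
  simp only [← mul_sum, Nat.sum_antidiagonal_eq_sum_range_succ_mk, sum_incr_mul_wordWeight ht]
  rw [coeff_C_mul, coeff_rescale, expq, coeff_mk, ← one_div, ← sum_pow_inv_mul_incr q n,
    ← mul_div_assoc, ← mul_div_assoc, mul_sum, mul_sum]
  congr 1
  refine sum_congr rfl fun π _ => ?_
  ring

theorem mul_inv_one_sub_eq_weightSeries {K : Type*} [Field K] {q y t : K}
    (hq : ∀ n : ℕ, qFactorial q n ≠ 0) (ht : 1 - t ≠ 0) :
    C (1 - t) * (1 - C t * (rescale y (bigExpq q) * expq q))⁻¹ = weightSeries q y t := by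
  have h0 : constantCoeff (1 - C t * (rescale y (bigExpq q) * expq q)) ≠ 0 := by
    have h := constantCoeff_rescale_mul_rescale q y 1
    rw [rescale_one, RingHom.id_apply] at h
    rw [map_sub, map_mul, h]
    simpa using ht
  have hmul : weightSeries q y t * (1 - C t * (rescale y (bigExpq q) * expq q)) = C (1 - t) := by
    have h1 := sub_mul_weightSeries (y := y) hq ht
    have h2 := rescale_bigExpq_mul_rescale_neg_expq hq y
    calc _ = rescale y (bigExpq q) * ((rescale (-y) (expq q) - C t * expq q) *
          weightSeries q y t) + weightSeries q y t *
            (1 - rescale y (bigExpq q) * rescale (-y) (expq q)) := by ring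
      _ = C (1 - t) * (rescale y (bigExpq q) * rescale (-y) (expq q)) := by
        rw [h1, h2, sub_self, mul_zero, add_zero, mul_left_comm, h2]
      _ = C (1 - t) := by rw [h2, mul_one]
  rw [← hmul, mul_assoc, PowerSeries.mul_inv_cancel _ h0, mul_one]

/-! ### Peaks and descents in terms of the descent pattern -/

/-- The number of peaks of a word of length `ℓ + 1` with descent pattern `w`, preceded by a
descent if `p` holds and by an ascent otherwise. -/
def patternPeaks : Bool → ℕ → (ℕ → Bool) → ℕ
  | _, 0, _ => 0
  | p, ℓ + 1, w => (if w 0 ∧ p = false then 1 else 0) + patternPeaks (w 0) ℓ (fun i => w (i + 1))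

/-- The number of descents of a word of length `ℓ + 1` with descent pattern `w`. -/
def patternDescents (ℓ : ℕ) (w : ℕ → Bool) : ℕ :=
  ∑ i ∈ range ℓ, if w i then 1 else 0

theorem patternDescents_succ (ℓ : ℕ) (w : ℕ → Bool) :
    patternDescents (ℓ + 1) w =
      (if w 0 then 1 else 0) + patternDescents ℓ (fun i => w (i + 1)) := by
  rw [patternDescents, sum_range_succ', add_comm, patternDescents]

theorem patternPeaks_eq_sum (p : Bool) (ℓ : ℕ) (w : ℕ → Bool) :
    patternPeaks p ℓ w =
      ∑ i ∈ range ℓ, if w i ∧ (if i = 0 then p else w (i - 1)) = false then 1 else 0 := by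
  induction ℓ generalizing p w with
  | zero => simp [patternPeaks]
  | succ ℓ ih =>
    rw [patternPeaks, sum_range_succ', add_comm, ih]
    congr 1
    refine sum_congr rfl fun i _ => ?_
    cases i <;> simp

theorem des_eq_patternDescents {ℓ : ℕ} (π : Equiv.Perm (Fin (ℓ + 1))) :
    des π = patternDescents ℓ (descPattern π) := by
  have h (i : Fin (ℓ + 1)) : (∃ h : (i : ℕ) + 1 < ℓ + 1, π ⟨(i : ℕ) + 1, h⟩ < π i) ↔
      descPattern π i = true := by
    rw [descPattern]
    split_ifs with hi <;> simp [hi]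
  rw [des, card_filter]
  simp only [h]
  rw [Fin.sum_univ_eq_sum_range (fun i => if descPattern π i = true then 1 else 0),
    sum_range_succ, patternDescents]
  simp [descPattern]

theorem pk_eq_patternPeaks {ℓ : ℕ} (π : Equiv.Perm (Fin (ℓ + 1))) :
    pk π = patternPeaks true ℓ (descPattern π) := by
  have h (i : Fin (ℓ + 1)) : (0 < (i : ℕ) ∧ ∃ h : (i : ℕ) + 1 < ℓ + 1,
      π ⟨(i : ℕ) - 1, (Nat.sub_le _ _).trans_lt i.isLt⟩ < π i ∧ π ⟨(i : ℕ) + 1, h⟩ < π i) ↔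
      descPattern π i ∧
        (if (i : ℕ) = 0 then true else descPattern π ((i : ℕ) - 1)) = false := by
    obtain ⟨i, hi⟩ := i
    cases i with
    | zero => simp
    | succ i =>
      -- A non-descent only gives `≤`; injectivity makes it the strict ascent that a peak needs.
      have hne : π ⟨i, by omega⟩ ≠ π ⟨i + 1, hi⟩ := fun he => by simpa using π.injective he
      simp only [descPattern, hi, Nat.add_sub_cancel, Nat.succ_ne_zero, if_false, dif_pos,
        decide_eq_false_iff_not, not_lt]
      split_ifs with h2
      · simp only [Nat.succ_pos, true_and, h2, exists_true_left, decide_eq_true_eq]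
        rw [hne.le_iff_lt, and_comm]
      · simp [h2]
  rw [pk, card_filter, patternPeaks_eq_sum]
  simp only [h]
  rw [Fin.sum_univ_eq_sum_range (fun i => if descPattern π i = true ∧
    (if i = 0 then true else descPattern π (i - 1)) = false then 1 else 0), sum_range_succ]
  simp [descPattern]

/-- The two starting states call each other, so they are proved together. The extra `(1 + y) * t`
pairs the unmatched valley with a virtual peak; each valley-peak pair then gives `(1 + y) ^ 2 * t =
(1 + y * t) ^ 2 * Y * T`. -/
theorem patternWeight_eq {K : Type*} [Field K] {y t : K} (hyt : y + t ≠ 0) (h1 : 1 + y * t ≠ 0)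
    (ℓ : ℕ) (w : ℕ → Bool) :
    ((1 + y) * t * patternWeight y t true ℓ w = (1 + y * t) ^ (ℓ + 2) *
      ((1 + y) ^ 2 * t / ((y + t) * (1 + y * t))) ^ (patternPeaks true ℓ w + 1) *
      ((y + t) / (1 + y * t)) ^ (patternDescents ℓ w + 1)) ∧
    (patternWeight y t false ℓ w = (1 + y * t) ^ (ℓ + 1) *
      ((1 + y) ^ 2 * t / ((y + t) * (1 + y * t))) ^ patternPeaks false ℓ w *
      ((y + t) / (1 + y * t)) ^ patternDescents ℓ w) := by
  set Y := (1 + y) ^ 2 * t / ((y + t) * (1 + y * t)) with hY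
  set T := (y + t) / (1 + y * t) with hT
  have hT' : y + t = (1 + y * t) * T := by rw [hT]; field_simp
  have hYT : (1 + y) ^ 2 * t = (1 + y * t) ^ 2 * (Y * T) := by rw [hT, hY]; field_simp
  clear_value Y T
  induction ℓ generalizing w with
  | zero =>
    simp only [patternWeight, patternPeaks, patternDescents, range_zero, sum_empty]
    exact ⟨by linear_combination hYT, by ring⟩
  | succ ℓ ih =>
    obtain ⟨ih1, ih2⟩ := ih fun i => w (i + 1)
    rw [patternDescents_succ]
    cases h : w 0 with
    | true =>
      simp only [patternWeight, patternPeaks, h, if_true, true_and, Bool.true_eq_false, if_false]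
      refine ⟨?_, ?_⟩
      · rw [hT']
        linear_combination (1 + y * t) * T * ih1
      · linear_combination ih1
    | false =>
      simp only [patternWeight, patternPeaks, h, false_and, Bool.false_eq_true, if_false]
      refine ⟨?_, ?_⟩
      · rw [ih2]
        linear_combination (1 + y * t) ^ (ℓ + 1) *
          Y ^ patternPeaks false ℓ (fun i => w (i + 1)) *
          T ^ patternDescents ℓ (fun i => w (i + 1)) * hYT
      · rw [ih2]; ring

theorem weightSeries_eq {K : Type*} [Field K] {q y t : K} (hy : 1 + y ≠ 0)
    (hyt : y + t ≠ 0) (h1 : 1 + y * t ≠ 0) :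
    weightSeries q y t = 1 + PowerSeries.mk fun n : ℕ =>
      if n = 0 then 0
      else (1 + y * t) ^ (n + 1) / ((1 + y) * (1 - t) ^ n) *
        invPkDes n q ((1 + y) ^ 2 * t / ((y + t) * (1 + y * t))) ((y + t) / (1 + y * t)) /
          qFactorial q n := by
  ext n
  cases n with
  | zero => simp [weightSeries, wordWeight, qFactorial, inv]
  | succ ℓ =>
    simp only [weightSeries, coeff_mk, map_add, coeff_one, Nat.succ_ne_zero, if_false, zero_add,
      invPkDes, mul_sum]
    congr 1
    refine sum_congr rfl fun π _ => ?_
    have h := (patternWeight_eq hyt h1 ℓ (descPattern π)).1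
    rw [← des_eq_patternDescents, ← pk_eq_patternPeaks] at h
    generalize (1 + y) ^ 2 * t / ((y + t) * (1 + y * t)) = Y, (y + t) / (1 + y * t) = T at h ⊢
    have h' : t * patternWeight y t true ℓ (descPattern π) =
        (1 + y * t) ^ (ℓ + 2) / (1 + y) *
        (Y ^ (pk π + 1) * T ^ (des π + 1)) := by
      rw [div_mul_eq_mul_div, eq_div_iff hy]
      linear_combination h
    simp only [wordWeight]
    rw [div_mul_eq_mul_div, h', ← div_div]
    ring

theorem inv_rescale {K : Type*} [Field K] (c : K) {f : PowerSeries K}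
    (hf : constantCoeff f ≠ 0) : (rescale c f)⁻¹ = rescale c f⁻¹ := by
  have h0 : constantCoeff (rescale c f) ≠ 0 := by
    rwa [← coeff_zero_eq_constantCoeff_apply, coeff_rescale, pow_zero, one_mul,
      coeff_zero_eq_constantCoeff_apply]
  rw [PowerSeries.inv_eq_iff_mul_eq_one h0, ← map_mul, PowerSeries.inv_mul_cancel _ hf, map_one]

/-- Differences of squares rationalize `v` to `(1 + t - s) / (1 + t + s)` and `u` to `(s - (1 - t))
/ (s + (1 - t))`. Then `1 + u * v`, `u + v`, `1 - v` and `1 + u` become monomials in `s` and `t`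
over nonzero factors. -/
theorem peak_descent_parametrization {K : Type*} [Field K] {y t s u v : K} (h2 : (2 : K) ≠ 0) (hy : y ≠ 0)
    (hy1 : y ≠ 1) (ht : t ≠ 0) (hs : s ^ 2 = (1 + t) ^ 2 - 4 * y * t) (hs0 : s ≠ 0)
    (hu : u = (1 + t ^ 2 - 2 * y * t - (1 - t) * s) / (2 * (1 - y) * t))
    (hv : v = ((1 + t) ^ 2 - 2 * y * t - (1 + t) * s) / (2 * y * t)) :
    1 + u * v ≠ 0 ∧ 1 - v ≠ 0 ∧ 1 + u ≠ 0 ∧ u + v ≠ 0 ∧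
      (1 + u) ^ 2 * v / ((u + v) * (1 + u * v)) = y ∧ (u + v) / (1 + u * v) = t := by
  have h4 : (4 : K) ≠ 0 := by
    rw [show (4 : K) = 2 * 2 by norm_num]; exact mul_ne_zero h2 h2
  have hy1' : 1 - y ≠ 0 := sub_ne_zero.2 hy1.symm
  have hA : (1 + t - s) * (1 + t + s) = 4 * y * t := by linear_combination -hs
  have hB : (s - (1 - t)) * (s + (1 - t)) = 4 * (1 - y) * t := by linear_combination hs
  have hA0 : 1 + t + s ≠ 0 := by
    refine right_ne_zero_of_mul (a := 1 + t - s) ?_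
    rw [hA]
    exact mul_ne_zero (mul_ne_zero h4 hy) ht
  have hB0 : s + (1 - t) ≠ 0 := by
    refine right_ne_zero_of_mul (a := s - (1 - t)) ?_
    rw [hB]
    exact mul_ne_zero (mul_ne_zero h4 hy1') ht
  have hv' : v = (1 + t - s) / (1 + t + s) := by
    rw [hv, div_eq_div_iff (mul_ne_zero (mul_ne_zero h2 hy) ht) hA0]
    linear_combination (1 + t) * hA
  have hu' : u = (s - (1 - t)) / (s + (1 - t)) := by
    rw [hu, div_eq_div_iff (mul_ne_zero (mul_ne_zero h2 hy1') ht) hB0]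
    linear_combination -(1 - t) * hs
  have huv : 1 + u * v = 4 * s / ((1 + t + s) * (s + (1 - t))) := by
    rw [hu', hv']; field_simp; ring
  have huv' : u + v = 4 * s * t / ((1 + t + s) * (s + (1 - t))) := by
    rw [hu', hv']; field_simp; ring
  have hv1 : 1 - v = 2 * s / (1 + t + s) := by
    rw [hv']; field_simp; ring
  have hu1 : 1 + u = 2 * s / (s + (1 - t)) := by
    rw [hu']; field_simp; ring
  refine ⟨?_, ?_, ?_, ?_, ?_, ?_⟩
  · rw [huv]
    exact div_ne_zero (mul_ne_zero h4 hs0) (mul_ne_zero hA0 hB0)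
  · rw [hv1]
    exact div_ne_zero (mul_ne_zero h2 hs0) hA0
  · rw [hu1]
    exact div_ne_zero (mul_ne_zero h2 hs0) hB0
  · rw [huv']
    exact div_ne_zero (mul_ne_zero (mul_ne_zero h4 hs0) ht) (mul_ne_zero hA0 hB0)
  · rw [huv, huv', hu1, hv', show y = (1 + t - s) * (1 + t + s) / (4 * t) by
      rw [hA]; field_simp]
    field_simp
    ring
  · rw [huv, huv']
    field_simp

end PkDes

open PkDes PowerSeries in
theorem theorem4p3 {K : Type*} [Field K] (q : K) (hq : ∀ n : ℕ, qFactorial q n ≠ 0) :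
    (∀ y t : K, 1 - t ≠ 0 → 1 + y ≠ 0 → y + t ≠ 0 → 1 + y * t ≠ 0 →
      C (1 - t) * (1 - C t * (rescale y (bigExpq q) * expq q))⁻¹ =
        1 + PowerSeries.mk fun n : ℕ =>
          if n = 0 then 0
          else (1 + y * t) ^ (n + 1) / ((1 + y) * (1 - t) ^ n) *
            invPkDes n q ((1 + y) ^ 2 * t / ((y + t) * (1 + y * t))) ((y + t) / (1 + y * t)) /
              qFactorial q n) ∧
    (∀ y t s u v : K, (2 : K) ≠ 0 → y ≠ 0 → y ≠ 1 → t ≠ 0 →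
      s ^ 2 = (1 + t) ^ 2 - 4 * y * t → s ≠ 0 →
      u = (1 + t ^ 2 - 2 * y * t - (1 - t) * s) / (2 * (1 - y) * t) →
      v = ((1 + t) ^ 2 - 2 * y * t - (1 + t) * s) / (2 * y * t) →
      1 + u * v ≠ 0 ∧ 1 - v ≠ 0 ∧
      (PowerSeries.mk fun n : ℕ => if n = 0 then 0 else invPkDes n q y t / qFactorial q n) =
        C (v * (1 + u) / (1 + u * v)) *
          (rescale (u * (1 - v) / (1 + u * v)) (bigExpq q) *
              rescale ((1 - v) / (1 + u * v)) (expq q) - 1) *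
          (1 - C v * (rescale (u * (1 - v) / (1 + u * v)) (bigExpq q) *
              rescale ((1 - v) / (1 + u * v)) (expq q)))⁻¹) := by
  have first (y t : K) (ht : 1 - t ≠ 0) (hy : 1 + y ≠ 0) (hyt : y + t ≠ 0)
      (h1 : 1 + y * t ≠ 0) :=
    (mul_inv_one_sub_eq_weightSeries (y := y) hq ht).trans (weightSeries_eq hy hyt h1)
  refine ⟨first, ?_⟩
  intro y t s u v h2 hy hy1 ht hs hs0 hu hv
  obtain ⟨h1uv, hv1, hu1, huv, hY, hT⟩ := peak_descent_parametrization h2 hy hy1 ht hs hs0 hu hv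
  refine ⟨h1uv, hv1, ?_⟩
  have key := first u v hv1 hu1 huv h1uv
  rw [hY, hT] at key
  have hc : u * (1 - v) / (1 + u * v) = u * ((1 - v) / (1 + u * v)) := by ring
  rw [hc]
  set c := (1 - v) / (1 + u * v) with hcdef
  have hF : rescale (u * c) (bigExpq q) * rescale c (expq q) =
      rescale c (rescale u (bigExpq q) * expq q) := by
    rw [map_mul, rescale_rescale]
  have hconst : constantCoeff (rescale u (bigExpq q) * expq q) = 1 := by
    simpa using constantCoeff_rescale_mul_rescale q u 1
  have h0 : constantCoeff (1 - C v * (rescale u (bigExpq q) * expq q)) ≠ 0 := by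
    rw [map_sub, map_mul, hconst]
    simpa using hv1
  rw [hF]
  generalize rescale u (bigExpq q) * expq q = F at key hconst h0 ⊢
  have hC (a : K) : rescale c (C a) = C a := by
    ext n
    rw [coeff_rescale, coeff_C]
    split_ifs with h <;> simp [h]
  have hden : 1 - C v * rescale c F = rescale c (1 - C v * F) := by
    rw [map_sub, map_mul, map_one, hC]
  -- This is `(1 - v) / (1 - v F) - 1 = v (F - 1) / (1 - v F)`. Rescaling by `c` then turns `((1 + u
  -- * v) / (1 - v)) ^ n` into `1`.
  have hseries : C v * (F - 1) * (1 - C v * F)⁻¹ = PowerSeries.mk fun n : ℕ =>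
      if n = 0 then 0
      else (1 + u * v) ^ (n + 1) / ((1 + u) * (1 - v) ^ n) * invPkDes n q y t /
        qFactorial q n := by
    rw [← sub_eq_iff_eq_add'] at key
    rw [← key]
    have hinv := PowerSeries.mul_inv_cancel _ h0
    rw [map_sub, map_one]
    linear_combination -hinv
  rw [hden, inv_rescale c h0,
    show v * (1 + u) / (1 + u * v) = (1 + u) / (1 + u * v) * v by ring, map_mul, mul_assoc,
    mul_assoc]
  have hres : C v * ((rescale c F - 1) * rescale c (1 - C v * F)⁻¹) =
      rescale c (C v * (F - 1) * (1 - C v * F)⁻¹) := by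
    rw [map_mul, map_mul, hC, map_sub, map_one, mul_assoc]
  rw [hres, hseries]
  ext n
  rw [coeff_C_mul, coeff_rescale, coeff_mk, coeff_mk]
  split_ifs with hn
  · simp
  · rw [hcdef, div_pow]
    have := hq n
    field_simp
    ring
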